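/- Let $\mathcal A$ be a set of propositional variables. MELL-formulas are generated by $$A,B ::= a \mid a^\perp \mid A ⅋ B \mid A\otimes B \mid {!}A \mid {?}A \mid \bot \mid 1 \qquad (a\in\mathcal A),$$ with linear negation $(\cdot)^\perp$ defined by the De Morgan laws: $a^{\perp\perp}=a$, $(A\otimes B)^\perp=A^\perp ⅋ B^\perp$, $(A⅋ B)^\perp=A^\perp\otimes B^\perp$, $({!}A)^\perp={?}A^\perp$, $({?}A)^\perp={!}A^\perp$, $1^\perp=\bot$, $\bot^\perp=1$. A sequent is a finite multiset of MELL-formulas. $\mathsf{MELL}$ is the cut-free one-sided sequent calculus with the rules (premises / conclusion) - ax: $/\ a,a^\perp$ for $a\in\mathcal A$; $\ ⅋$: $\Gamma,A,B\ /\ \Gamma,A⅋ B$; $\ \otimes$: $\Gamma,A$ and $B,\Delta\ /\ \Gamma,A\otimes B,\Delta$; - $\bot$: $\Gamma\ /\ \Gamma,\bot$; $\ 1$: $/\ 1$; - promotion: $A,{?}\Gamma\ /\ {!}A,{?}\Gamma$; dereliction: $\Gamma,A\ /\ \Gamma,{?}A$; weakening: $\Gamma\ /\ \Gamma,{?}A$;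 contraction: $\Gamma,{?}A,{?}A\ /\ \Gamma,{?}A$; and $\mathsf{MELL}\cup\{\mathsf{cut}\}$ has in addition the rule cut: $\Gamma,A$ and $A^\perp,\Delta\ /\ \Gamma,\Delta$, with active formulas $(A,A^\perp)$. Write $\vdash_{\mathsf{MELL}}\Gamma$ if $\Gamma$ is derivable in $\mathsf{MELL}$. Write ${?}^nF$ for $F$ prefixed by $n\ge 0$ copies of ${?}$. A weaken-contradiction is a formula of the form ${?}^n(A\otimes A^\perp)$ with $n\in\mathbb N$ and $A$ a MELL-formula. **Theorem.** Let $\Gamma$ be a sequent. 1. If $C_1,\dots,C_n$ are weaken-contradictions ($n\ge 0$) and $\vdash_{\mathsf{MELL}}\Gamma,C_1,\dots,C_n$, then $\vdash_{\mathsf{MELL}}\Gamma$. 2. Conversely, if $\Gamma$ has a derivation in $\mathsf{MELL}\cup\{\mathsf{cut}\}$ containing exactly $k$ occurrences of the cut rule, with pairs of active formulas $(A_1,A_1^\perp),\dots,(A_k,A_k^\perp)$, then there are $n_1,\dots,n_k\in\mathbb N$ with $$\vdash_{\mathsf{MELL}}\Gamma,{?}^{n_1}(A_1\otimes A_1^\perp),\dots,{?}^{n_k}(A_k\otimes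 A_k^\perp).$$ -/

import Mathlib

namespace MELL

/-- Formulas of multiplicative exponential linear logic with units, in negation normal form,
over the propositional variables `α`. -/
inductive Formula (α : Type*) where
  | pos (a : α) : Formula α
  | neg (a : α) : Formula α
  | par (A B : Formula α) : Formula α
  | tensor (A B : Formula α) : Formula α
  | ofCourse (A : Formula α) : Formula α
  | whyNot (A : Formula α) : Formula α
  | bot : Formula α
  | one : Formula α

namespace Formula

variable {α : Type*}

/-- Linear negation, by the De Morgan laws. -/
def dual : Formula α → Formula α
  | pos a => neg a
  | neg a => pos a
  | par A B => tensor A.dual B.dual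
  | tensor A B => par A.dual B.dual
  | ofCourse A => whyNot A.dual
  | whyNot A => ofCourse A.dual
  | bot => one
  | one => bot

theorem dual_dual (A : Formula α) : A.dual.dual = A := by
  induction A <;> simp_all [dual]

/-- `whyNotPow n A` is `A` prefixed by `n` occurrences of the modality `?`. -/
def whyNotPow : ℕ → Formula α → Formula α
  | 0, A => A
  | n + 1, A => whyNot (whyNotPow n A)

/-- The contradiction `A ⊗ A⊥`. -/
def contradiction (A : Formula α) : Formula α := tensor A A.dual

/-- A weaken-contradiction is a formula `?ⁿ(A ⊗ A⊥)`. -/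
def IsWeakenContradiction (C : Formula α) : Prop :=
  ∃ (n : ℕ) (A : Formula α), C = whyNotPow n (contradiction A)

end Formula

open Formula

/-- Sequents are finite multisets of formulas, so that no exchange rule is needed. -/
abbrev Sequent (α : Type*) := Multiset (Formula α)

/-- Derivations of the one-sided sequent calculus for MELL together with the cut rule.
Axioms are restricted to literals. -/
inductive Derivation {α : Type*} : Sequent α → Type _ where
  | ax (a : α) : Derivation {pos a, neg a}
  | par {Γ : Sequent α} {A B : Formula α} :
      Derivation (A ::ₘ B ::ₘ Γ) → Derivation (Formula.par A B ::ₘ Γ)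
  | tensor {Γ Δ : Sequent α} {A B : Formula α} :
      Derivation (A ::ₘ Γ) → Derivation (B ::ₘ Δ) → Derivation (Formula.tensor A B ::ₘ (Γ + Δ))
  | bot {Γ : Sequent α} : Derivation Γ → Derivation (Formula.bot ::ₘ Γ)
  | one : Derivation {Formula.one}
  | promotion {Γ : Sequent α} {A : Formula α} :
      Derivation (A ::ₘ Γ.map whyNot) → Derivation (ofCourse A ::ₘ Γ.map whyNot)
  | dereliction {Γ : Sequent α} {A : Formula α} :
      Derivation (A ::ₘ Γ) → Derivation (whyNot A ::ₘ Γ)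
  | weakening {Γ : Sequent α} {A : Formula α} :
      Derivation Γ → Derivation (whyNot A ::ₘ Γ)
  | contraction {Γ : Sequent α} {A : Formula α} :
      Derivation (whyNot A ::ₘ whyNot A ::ₘ Γ) → Derivation (whyNot A ::ₘ Γ)
  | cut {Γ Δ : Sequent α} (A : Formula α) :
      Derivation (A ::ₘ Γ) → Derivation (A.dual ::ₘ Δ) → Derivation (Γ + Δ)

/-- The multiset with one entry `A` for each occurrence in the derivation of the cut rule with
active formulas `A` and `A⊥`. -/
def Derivation.cutFormulas {α : Type*} {Γ : Sequent α} : Derivation Γ → Multiset (Formula α)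
  | .ax _ => 0
  | .par d => d.cutFormulas
  | .tensor d e => d.cutFormulas + e.cutFormulas
  | .bot d => d.cutFormulas
  | .one => 0
  | .promotion d => d.cutFormulas
  | .dereliction d => d.cutFormulas
  | .weakening d => d.cutFormulas
  | .contraction d => d.cutFormulas
  | .cut A d e => A ::ₘ (d.cutFormulas + e.cutFormulas)

/-- Provability in the cut-free calculus MELL: there is a derivation without cuts. -/
def Provable {α : Type*} (Γ : Sequent α) : Prop :=
  ∃ d : Derivation Γ, d.cutFormulas = 0

end MELL

open scoped Pointwise

namespace MELL

open Formula

variable {α : Type*}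

/-! ### The rules of the cut-free calculus -/

namespace Provable

variable {Γ Δ : Sequent α} {A B : Formula α}

/-! Part 1 rests on phase semantics in the style of Okada. Sequents form a commutative monoid whose
pole is cut-free provability, and `interp A` is a biorthogonally closed set. By `Derivation.valid`,
every sum of refutations of a derivable sequent is cut-free provable. `Γ` is a sum of refutations of
itself (`singleton_mem_orth_interp`), and the empty sequent refutes every weaken-contradiction, so
`Γ + 0` is provable. Part 2 turns each cut into a tensor, whose contradiction travels down the
derivation; promotions below it cost extra `?`. -/

theorem ax (a : α) : Provable ({pos a, neg a} : Sequent α) := ⟨.ax a, rfl⟩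

theorem par : Provable (A ::ₘ B ::ₘ Γ) → Provable (Formula.par A B ::ₘ Γ) :=
  fun ⟨d, h⟩ => ⟨.par d, h⟩

theorem tensor : Provable (A ::ₘ Γ) → Provable (B ::ₘ Δ) →
    Provable (Formula.tensor A B ::ₘ (Γ + Δ)) :=
  fun ⟨d, h⟩ ⟨e, k⟩ => ⟨.tensor d e, by simp [Derivation.cutFormulas, h, k]⟩

theorem bot : Provable Γ → Provable (Formula.bot ::ₘ Γ) :=
  fun ⟨d, h⟩ => ⟨.bot d, h⟩

theorem one : Provable ({Formula.one} : Sequent α) := ⟨.one, rfl⟩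

theorem promotion : Provable (A ::ₘ Γ.map whyNot) → Provable (ofCourse A ::ₘ Γ.map whyNot) :=
  fun ⟨d, h⟩ => ⟨.promotion d, h⟩

theorem dereliction : Provable (A ::ₘ Γ) → Provable (whyNot A ::ₘ Γ) :=
  fun ⟨d, h⟩ => ⟨.dereliction d, h⟩

theorem weakening : Provable Γ → Provable (whyNot A ::ₘ Γ) :=
  fun ⟨d, h⟩ => ⟨.weakening d, h⟩

theorem contraction : Provable (whyNot A ::ₘ whyNot A ::ₘ Γ) → Provable (whyNot A ::ₘ Γ) :=
  fun ⟨d, h⟩ => ⟨.contraction d, h⟩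

theorem add_map_whyNot (h : Provable Γ) (Δ : Sequent α) : Provable (Γ + Δ.map whyNot) := by
  induction Δ using Multiset.induction with
  | empty => simpa using h
  | cons A Δ ih => simpa using ih.weakening

theorem of_add_map_whyNot_twice (Δ : Sequent α) :
    ∀ {Γ : Sequent α}, Provable (Γ + Δ.map whyNot + Δ.map whyNot) →
      Provable (Γ + Δ.map whyNot) := by
  induction Δ using Multiset.induction with
  | empty => intro Γ h; simpa using h
  | cons A Δ ih =>
    intro Γ h
    have h' : Provable ((whyNot A ::ₘ whyNot A ::ₘ Γ) + Δ.map whyNot + Δ.map whyNot) := by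
      simpa using h
    simpa using (show Provable (whyNot A ::ₘ whyNot A ::ₘ (Γ + Δ.map whyNot)) by
      simpa using ih h').contraction

theorem dereliction_map (Δ : Sequent α) :
    ∀ {Γ : Sequent α}, Provable (Γ + Δ) → Provable (Γ + Δ.map whyNot) := by
  induction Δ using Multiset.induction with
  | empty => intro Γ h; simpa using h
  | cons A Δ ih =>
    intro Γ h
    have h' : Provable (A ::ₘ Γ + Δ) := by simpa using h
    have h'' : Provable (A ::ₘ (Γ + Δ.map whyNot)) := by simpa using ih h'
    simpa using h''.dereliction

end Provable

/-! ### The phase space of sequents -/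

/-- The orthogonal of a set of sequents, with the provable sequents as pole. -/
def orth (X : Set (Sequent α)) : Set (Sequent α) := {m | ∀ x ∈ X, Provable (m + x)}

theorem subset_orth_orth (X : Set (Sequent α)) : X ⊆ orth (orth X) :=
  fun x hx y hy => add_comm y x ▸ hy x hx

theorem orth_anti {X Y : Set (Sequent α)} (h : X ⊆ Y) : orth Y ⊆ orth X :=
  fun _ hm x hx => hm x (h hx)

theorem orth_orth_orth (X : Set (Sequent α)) : orth (orth (orth X)) = orth X :=
  (orth_anti (subset_orth_orth X)).antisymm (subset_orth_orth _)

/-- The sequents all of whose formulas are of the form `?A`. -/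
def whyNotSequents : Set (Sequent α) := Set.range (Multiset.map whyNot)

/-- The interpretation of formulas in the phase space of sequents. -/
def interp : Formula α → Set (Sequent α)
  | .pos a => orth {{pos a}}
  | .neg a => orth (orth {{pos a}})
  | .par A B => orth (orth (interp A) + orth (interp B))
  | .tensor A B => orth (orth (interp A + interp B))
  | .ofCourse A => orth (orth (interp A ∩ whyNotSequents))
  | .whyNot A => orth (orth (interp A) ∩ whyNotSequents)
  | .bot => orth {0}
  | .one => orth (orth {0})

theorem orth_orth_interp (A : Formula α) : orth (orth (interp A)) = interp A := by
  cases A <;> simp only [interp, orth_orth_orth]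

theorem interp_dual (A : Formula α) : interp A.dual = orth (interp A) := by
  induction A with
  | par A B ihA ihB => simp only [dual, interp, ihA, ihB]
  | tensor A B ihA ihB => simp only [dual, interp, ihA, ihB, orth_orth_interp, orth_orth_orth]
  | ofCourse A ih => simp only [dual, interp, ih, orth_orth_interp, orth_orth_orth]
  | whyNot A ih => simp only [dual, interp, ih]
  | _ => simp only [dual, interp, orth_orth_orth]

/-- Okada's lemma: orthogonality to a biorthogonal can be tested on generators, and there each case
is the rule introducing the connective. -/
theorem singleton_mem_orth_interp (A : Formula α) : {A} ∈ orth (interp A) := by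
  induction A with
  | pos a => exact subset_orth_orth _ rfl
  | neg a =>
    rw [interp, orth_orth_orth]
    rintro _ rfl
    rw [add_comm]
    exact Provable.ax a
  | par A B ihA ihB =>
    intro x hx
    have h := hx _ (Set.add_mem_add ihA ihB)
    rw [add_comm x, add_assoc] at h
    exact (Provable.par h :)
  | tensor A B ihA ihB =>
    rw [interp, orth_orth_orth]
    rintro _ ⟨x, hx, y, hy, rfl⟩
    exact (Provable.tensor (ihA x hx) (ihB y hy) :)
  | ofCourse A ih =>
    rw [interp, orth_orth_orth]
    rintro _ ⟨hx, Δ, rfl⟩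
    exact (Provable.promotion (ih _ hx) :)
  | whyNot A ih =>
    refine subset_orth_orth _ ⟨fun x hx => ?_, {A}, rfl⟩
    exact (Provable.dereliction (ih x hx) :)
  | bot =>
    intro x hx
    exact Provable.bot (by simpa using hx 0 rfl)
  | one =>
    rw [interp, orth_orth_orth]
    rintro _ rfl
    simpa using Provable.one

/-! ### Soundness of the calculus with cut -/

/-- The set of sums of refutations of the formulas of a sequent. -/
def refutations (Γ : Sequent α) : Set (Sequent α) :=
  (Γ.map fun A => orth (interp A)).sum

theorem refutations_cons (A : Formula α) (Γ : Sequent α) :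
    refutations (A ::ₘ Γ) = orth (interp A) + refutations Γ := by
  simp [refutations]

theorem refutations_add (Γ Δ : Sequent α) :
    refutations (Γ + Δ) = refutations Γ + refutations Δ := by
  simp [refutations]

theorem self_mem_refutations (Γ : Sequent α) : Γ ∈ refutations Γ := by
  induction Γ using Multiset.induction with
  | empty => exact Set.mem_zero.2 rfl
  | cons A Γ ih =>
    rw [refutations_cons]
    exact Set.add_mem_add (singleton_mem_orth_interp A) ih

/-- A sequent is valid if all its refutations are provable. -/
def Valid (Γ : Sequent α) : Prop := ∀ m ∈ refutations Γ, Provable m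

/-- Biorthogonal closure of `interp A` lets the principal formula of a rule change sides. -/
theorem valid_cons_iff {A : Formula α} {Γ : Sequent α} :
    Valid (A ::ₘ Γ) ↔ refutations Γ ⊆ interp A := by
  rw [Valid, refutations_cons]
  constructor
  · intro h m hm
    rw [← orth_orth_interp A]
    intro x hx
    rw [add_comm]
    exact h _ (Set.add_mem_add hx hm)
  · rintro h _ ⟨x, hx, m, hm, rfl⟩
    exact hx m (h hm)

/-- This is what promotion needs of its context: refutations of `?A` form the biorthogonal of a set
of `?`-sequents, so they can be replaced by such sequents one at a time, with `t` holding those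
already replaced. -/
theorem provable_add_of_refutations_map_whyNot (Γ : Sequent α) :
    ∀ t : Sequent α,
      (∀ m ∈ refutations (Γ.map whyNot) ∩ whyNotSequents, Provable (m + t)) →
      ∀ m ∈ refutations (Γ.map whyNot), Provable (m + t) := by
  induction Γ using Multiset.induction with
  | empty =>
    intro t h m hm
    exact h m ⟨hm, 0, (Set.mem_zero.1 hm).symm⟩
  | cons A Γ ih =>
    intro t h
    rw [Multiset.map_cons, refutations_cons] at h ⊢
    rintro _ ⟨x, hx, m, hm, rfl⟩
    change Provable (x + m + t)
    rw [add_assoc]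
    refine hx _ fun y hy => ?_
    rw [add_assoc]
    refine ih _ (fun k hk => ?_) m hm
    obtain ⟨hk, Δ, rfl⟩ := hk
    obtain ⟨hyA, Δ', rfl⟩ := hy
    have h' := h (Δ'.map whyNot + Δ.map whyNot)
      ⟨Set.add_mem_add (subset_orth_orth _ ⟨hyA, Δ', rfl⟩) hk, Δ' + Δ, Multiset.map_add ..⟩
    convert h' using 1
    abel

theorem Derivation.valid {Γ : Sequent α} (d : Derivation Γ) : Valid Γ := by
  induction d with
  | ax a =>
    refine valid_cons_iff.2 ?_
    simp only [refutations, Multiset.map_singleton, Multiset.sum_singleton, interp,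
      orth_orth_orth, subset_rfl]
  | par _ ih =>
    refine valid_cons_iff.2 fun m hm => ?_
    rintro _ ⟨x, hx, y, hy, rfl⟩
    have h := ih (x + (y + m)) (by
      rw [refutations_cons, refutations_cons]
      exact Set.add_mem_add hx (Set.add_mem_add hy hm))
    convert h using 1
    exact (add_comm _ _).trans (add_assoc _ _ _)
  | tensor _ _ ihA ihB =>
    refine valid_cons_iff.2 ?_
    rw [refutations_add]
    exact (Set.add_subset_add (valid_cons_iff.1 ihA) (valid_cons_iff.1 ihB)).trans
      (subset_orth_orth _)
  | bot _ ih =>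
    refine valid_cons_iff.2 fun m hm => ?_
    rintro _ rfl
    simpa using ih m hm
  | one => exact valid_cons_iff.2 (subset_orth_orth _)
  | @promotion Γ A _ ih =>
    refine valid_cons_iff.2 fun m hm t ht =>
      provable_add_of_refutations_map_whyNot Γ t (fun k hk => ?_) m hm
    exact add_comm t k ▸ ht k ⟨valid_cons_iff.1 ih hk.1, hk.2⟩
  | dereliction _ ih =>
    refine valid_cons_iff.2 fun m hm x hx => ?_
    exact add_comm x m ▸ hx.1 m (valid_cons_iff.1 ih hm)
  | weakening _ ih =>
    refine valid_cons_iff.2 fun m hm => ?_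
    rintro _ ⟨-, Δ, rfl⟩
    exact (ih m hm).add_map_whyNot Δ
  | contraction _ ih =>
    refine valid_cons_iff.2 fun m hm => ?_
    rintro _ ⟨hx, Δ, rfl⟩
    have hx' := subset_orth_orth _ (show Δ.map whyNot ∈ _ ∩ whyNotSequents from ⟨hx, Δ, rfl⟩)
    refine Provable.of_add_map_whyNot_twice Δ ?_
    have h := ih _ (by
      rw [refutations_cons, refutations_cons]
      exact Set.add_mem_add hx' (Set.add_mem_add hx' hm))
    convert h using 1
    change _ = Δ.map whyNot + (Δ.map whyNot + m)
    abel
  | cut A _ _ ihA ihB =>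
    intro m hm
    rw [refutations_add] at hm
    obtain ⟨x, hx, y, hy, rfl⟩ := hm
    -- The premises place `x` in `interp A` and `y` in its orthogonal, so their sum lies in the
    -- pole.
    have h := valid_cons_iff.1 ihB hy
    rw [interp_dual] at h
    exact (add_comm y x ▸ h x (valid_cons_iff.1 ihA hx) : Provable (x + y))

/-! ### Weaken-contradictions -/

/-- An element of `interp A` plus one of its orthogonal is provable by definition. Each further `?`
is harmless because the empty sequent is a `?`-sequent. -/
theorem zero_mem_orth_interp_contradiction (A : Formula α) (n : ℕ) :
    (0 : Sequent α) ∈ orth (interp (whyNotPow n (contradiction A))) := by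
  induction n with
  | zero =>
    rw [whyNotPow, contradiction, interp, orth_orth_orth, interp_dual]
    rintro _ ⟨x, hx, y, hy, rfl⟩
    simpa [add_comm] using hy x hx
  | succ n ih => exact subset_orth_orth _ ⟨ih, 0, rfl⟩

theorem Provable.of_add_isWeakenContradiction {Γ Δ : Sequent α}
    (hΔ : ∀ C ∈ Δ, IsWeakenContradiction C) (h : Provable (Γ + Δ)) : Provable Γ := by
  obtain ⟨d, -⟩ := h
  have hzero : (0 : Sequent α) ∈ refutations Δ := by
    clear d
    induction Δ using Multiset.induction with
    | empty => exact Set.mem_zero.2 rfl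
    | cons C Δ ih =>
      rw [refutations_cons, ← add_zero (0 : Sequent α)]
      obtain ⟨n, A, rfl⟩ := hΔ C (Multiset.mem_cons_self _ _)
      exact Set.add_mem_add (zero_mem_orth_interp_contradiction A n)
        (ih fun C hC => hΔ C (Multiset.mem_cons_of_mem hC))
  refine d.valid Γ ?_
  rw [refutations_add, ← add_zero Γ]
  exact Set.add_mem_add (by simpa using self_mem_refutations Γ) hzero

/-! ### Trading cuts for weaken-contradictions -/

/-- The contradictions `?ⁿ(A ⊗ A⊥)` for `A` in a multiset of formulas. -/
def contradictions (n : ℕ) (M : Multiset (Formula α)) : Sequent α :=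
  M.map fun A => whyNotPow n (contradiction A)

theorem contradictions_add (n : ℕ) (M N : Multiset (Formula α)) :
    contradictions n (M + N) = contradictions n M + contradictions n N :=
  Multiset.map_add ..

theorem map_whyNot_contradictions (n : ℕ) (M : Multiset (Formula α)) :
    (contradictions n M).map whyNot = contradictions (n + 1) M :=
  Multiset.map_map ..

theorem Provable.contradictions_mono {Γ : Sequent α} {M : Multiset (Formula α)} {m n : ℕ}
    (hmn : m ≤ n) (h : Provable (Γ + contradictions m M)) :
    Provable (Γ + contradictions n M) := by
  induction hmn with
  | refl => exact h
  | step _ ih =>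
    rw [← map_whyNot_contradictions]
    exact Provable.dereliction_map _ ih

/-- A single exponent serves all cuts, since dereliction can raise the smaller one when two premises
meet. -/
theorem Derivation.exists_provable_add_contradictions {Γ : Sequent α} (d : Derivation Γ) :
    ∃ n, Provable (Γ + contradictions n d.cutFormulas) := by
  induction d with
  | ax a => exact ⟨0, by simpa [cutFormulas, contradictions] using Provable.ax a⟩
  | one => exact ⟨0, by simpa [cutFormulas, contradictions] using Provable.one⟩
  | par _ ih =>
    obtain ⟨n, h⟩ := ih
    exact ⟨n, by simpa [cutFormulas] using Provable.par (by simpa using h)⟩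
  | bot _ ih =>
    obtain ⟨n, h⟩ := ih
    exact ⟨n, by simpa [cutFormulas] using h.bot⟩
  | dereliction _ ih =>
    obtain ⟨n, h⟩ := ih
    exact ⟨n, by simpa [cutFormulas] using Provable.dereliction (by simpa using h)⟩
  | weakening _ ih =>
    obtain ⟨n, h⟩ := ih
    exact ⟨n, by simpa [cutFormulas] using h.weakening⟩
  | contraction _ ih =>
    obtain ⟨n, h⟩ := ih
    exact ⟨n, by simpa [cutFormulas] using Provable.contraction (by simpa using h)⟩
  | @promotion Γ A d ih =>
    obtain ⟨n, h⟩ := ih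
    refine ⟨n + 1, ?_⟩
    -- Promotion requires a context of `?`-formulas, hence one more `?` on every contradiction.
    have h' := Provable.dereliction_map _ h
    rw [Multiset.cons_add, ← Multiset.map_add] at h'
    have := h'.promotion
    rwa [Multiset.map_add, map_whyNot_contradictions, ← Multiset.cons_add] at this
  | tensor d e ihd ihe =>
    obtain ⟨m, hm⟩ := ihd
    obtain ⟨n, hn⟩ := ihe
    have hm := hm.contradictions_mono (le_max_left m n)
    have hn := hn.contradictions_mono (le_max_right m n)
    refine ⟨max m n, ?_⟩
    rw [Multiset.cons_add] at hm hn
    have h := hm.tensor hn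
    rwa [add_add_add_comm, ← contradictions_add, ← Multiset.cons_add] at h
  | cut A d e ihd ihe =>
    obtain ⟨m, hm⟩ := ihd
    obtain ⟨n, hn⟩ := ihe
    have hm := hm.contradictions_mono (le_max_left m n)
    have hn := hn.contradictions_mono (le_max_right m n)
    refine ⟨max m n, ?_⟩
    rw [Multiset.cons_add] at hm hn
    have h := hm.tensor hn
    rw [add_add_add_comm, ← contradictions_add] at h
    rw [← Multiset.singleton_add, add_comm] at h
    -- The new `A ⊗ A⊥` starts with exponent 0 and is raised to the common one.
    have h' := Provable.contradictions_mono (M := {A}) (Nat.zero_le (max m n)) h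
    rwa [add_assoc, ← contradictions_add, add_comm (cutFormulas d + _),
      Multiset.singleton_add] at h'

end MELL

theorem mainTheorem10 {α : Type*} (Γ : MELL.Sequent α) :
    (∀ (n : ℕ) (C : Fin n → MELL.Formula α),
      (∀ i, MELL.Formula.IsWeakenContradiction (C i)) →
      MELL.Provable (Γ + Finset.univ.val.map C) → MELL.Provable Γ) ∧
    (∀ (d : MELL.Derivation Γ) (k : ℕ) (A : Fin k → MELL.Formula α),
      d.cutFormulas = Finset.univ.val.map A →
      ∃ n : Fin k → ℕ,
        MELL.Provable (Γ + Finset.univ.val.map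
          (fun i => MELL.Formula.whyNotPow (n i) (MELL.Formula.contradiction (A i))))) := by
  refine ⟨fun n C hC h => h.of_add_isWeakenContradiction ?_, fun d k A hA => ?_⟩
  · intro D hD
    obtain ⟨i, -, rfl⟩ := Multiset.mem_map.1 hD
    exact hC i
  · obtain ⟨n, h⟩ := d.exists_provable_add_contradictions
    refine ⟨fun _ => n, ?_⟩
    rw [hA, MELL.contradictions, Multiset.map_map] at h
    exact h
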